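/- **Proposition (expression of the influence function of $f_{P,\lambda}$).** Let $X\subset\mathbb R^n$, $Y\subset\mathbb R$, $Z=X\times Y$ with points $z=(x,y)$ and norm $\|z\|=\max\{\|x\|_2,|y|\}$. Let $\mathcal H_k$ be the reproducing kernel Hilbert space on $X$ of a continuous kernel $k$, write $k_x=k(\cdot,x)$ and $T_xh=\langle k_x,h\rangle k_x=h(x)k_x$, let $\mathcal F\subset\mathcal H_k$ be convex, with normal cone $\mathcal N_{\mathcal F}(f)=\{d:\langle d,g-f\rangle\le 0\ \forall g\in\mathcal F\}$ for $f\in\mathcal F$ and $\mathcal N_{\mathcal F}(f)=\emptyset$ for $f\notin\mathcal F$. Let $\lambda\ge 0$, let $c:Z\times\mathbb R\to\mathbb R$ be a cost function with derivatives $c_2',c_2''$ in the second argument, and let $P$ be a probability measure on $Z$. Assume: 1. $c(z,\cdot)$ is convex for $P$-almost every $z$ and twice continuously differentiable for every $z\in Z$, and there are $C_2>0$, $p_2\ge 1$ such that, with $L_{p}(z_1,z_2)=\max\{1,\|z_1\|,\|z_2\|\}^{p-1}$, $$|c_2''(z_1,w_1)-c_2''(z_2,w_2)|\le C_2L_{p_2}(z_1,z_2)\,(\|z_1-z_2\|+|w_1-w_2|)\qquad\forall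 z_1,z_2\in Z,\ w_1,w_2\in\mathbb R;$$ 2. for $Q=P$ and for $Q=(1-t)P+t\delta_{\tilde z}$, $t\in(0,1)$, where $\tilde z=(\tilde x,\tilde y)\in Z$ is fixed, the generalized equation $0\in\mathbb E_Q[c_2'(z,f(x))k_x]+2\lambda f+\mathcal N_{\mathcal F}(f)$ has a unique solution, denoted $f_{Q,\lambda}$; 3. $\mathbb E_P[|c_2'(z,f_{P,\lambda}(x))|\,\|k_x\|_k]<\infty$ and $\mathbb E_P[|c_2''(z,f_{P,\lambda}(x))|\,\|T_xh\|_k]<\infty$ for all $h\in\mathcal H_k$, and $\mathbb E_P[L_{p_2}(z,z)\|k_x\|_k^3]<\infty$; 4. the influence function $$\mathrm{IF}=\mathrm{IF}(\tilde z;f_{(\cdot,\lambda)},P)=\lim_{t\downarrow 0}\frac{f_{(1-t)P+t\delta_{\tilde z},\lambda}-f_{P,\lambda}}{t}$$ exists in $\mathcal H_k$. Let $u^*=-\mathbb E_P[c_2'(z,f_{P,\lambda}(x))k_x]-2\lambda f_{P,\lambda}$. (i) If $\mathcal N_{\mathcal F}$ is proto-differentiable at $f_{P,\lambda}$ for $u^*\in\mathcal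 N_{\mathcal F}(f_{P,\lambda})$, that is, if the graphs of $d\mapsto\varepsilon^{-1}(\mathcal N_{\mathcal F}(f_{P,\lambda}+\varepsilon d)-u^*)$ have, as $\varepsilon\downarrow 0$, equal outer and inner limits, which then form the graph of the proto-derivative $(\mathcal N_{\mathcal F})'_{f_{P,\lambda},u^*}$, then $h=\mathrm{IF}$ solves $$-c_2'(\tilde z,f_{P,\lambda}(\tilde x))k_{\tilde x}+\mathbb E_P[c_2'(z,f_{P,\lambda}(x))k_x]-\mathbb E_P[c_2''(z,f_{P,\lambda}(x))T_xh]-2\lambda h\in(\mathcal N_{\mathcal F})'_{f_{P,\lambda},u^*}(h),$$ and if $\lambda>0$ it is the only solution $h\in\mathcal H_k$ of this inclusion. (ii) If $\mathcal F=\mathcal H_k$ and the Hessian operator $h\mapsto\mathbb E_P[c_2''(z,f_{P,\lambda}(x))T_xh]+2\lambda h$ from $\mathcal H_k$ to $\mathcal H_k$ is one-to-one and onto, then, with $I$ the identity of $\mathcal H_k$, $$\mathrm{IF}=-\bigl(\mathbb E_P[c_2''(z,f_{P,\lambda}(x))T_x]+2\lambda I\bigr)^{-1}\bigl(c_2'(\tilde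 z,f_{P,\lambda}(\tilde x))k_{\tilde x}-\mathbb E_P[c_2'(z,f_{P,\lambda}(x))k_x]\bigr).$$ -/

import Mathlib

open MeasureTheory Filter Topology Set

noncomputable section

namespace KernelIF

/-! ### Set convergence and proto-derivatives in a Hilbert space -/

section Proto

variable {H : Type*} [NormedAddCommGroup H] [InnerProductSpace ℝ H]

/-- Outer limit of the sets `A ε` as `ε ↓ 0`: the limits of sequences `a k ∈ A (t k)` for some
sequence `t k ↓ 0`. -/
def outerLimit {E : Type*} [TopologicalSpace E] (A : ℝ → Set E) : Set E :=
  {a | ∃ t : ℕ → ℝ, (∀ k, 0 < t k) ∧ Tendsto t atTop (𝓝 0) ∧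
    ∃ b : ℕ → E, Tendsto b atTop (𝓝 a) ∧ ∀ k, b k ∈ A (t k)}

/-- Inner limit of the sets `A ε` as `ε ↓ 0`: the points `a` such that for every sequence
`t k ↓ 0` there are `b k → a` with `b k ∈ A (t k)` for all but finitely many `k`. -/
def innerLimit {E : Type*} [TopologicalSpace E] (A : ℝ → Set E) : Set E :=
  {a | ∀ t : ℕ → ℝ, (∀ k, 0 < t k) → Tendsto t atTop (𝓝 0) →
    ∃ b : ℕ → E, Tendsto b atTop (𝓝 a) ∧ ∀ᶠ k in atTop, b k ∈ A (t k)}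

/-- The graph of a set-valued mapping. -/
def gph (Γ : H → Set H) : Set (H × H) := {p | p.2 ∈ Γ p.1}

/-- The difference quotient mapping `d ↦ (Γ (f + ε d) - u) / ε`. -/
def diffQuot (Γ : H → Set H) (f u : H) (ε : ℝ) (d : H) : Set H :=
  {g | ∃ v ∈ Γ (f + ε • d), g = ε⁻¹ • (v - u)}

/-- `Γ` is proto-differentiable at `f` for `u ∈ Γ f`, with proto-derivative `D`: the difference
quotient mappings graph-converge to `D` as `ε ↓ 0`. -/
def HasProtoDerivAt (Γ : H → Set H) (f u : H) (D : H → Set H) : Prop :=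
  u ∈ Γ f ∧
  outerLimit (fun ε => gph (diffQuot Γ f u ε)) = gph D ∧
  innerLimit (fun ε => gph (diffQuot Γ f u ε)) = gph D

/-- The normal cone mapping of a set `F`; it is empty at the points outside `F`. -/
def normalCone (F : Set H) (f : H) : Set H :=
  {d | f ∈ F ∧ ∀ g ∈ F, inner ℝ d (g - f) ≤ 0}

end Proto

/-! ### The kernel learning problem -/

section Learning

variable {n : ℕ} {X : Set (EuclideanSpace ℝ (Fin n))} {Y : Set ℝ}

/-- A data point `z = (x, y) ∈ Z = X × Y` as a vector. -/
def vec (z : X × Y) : EuclideanSpace ℝ (Fin n) × ℝ := ((z.1 : EuclideanSpace ℝ (Fin n)), (z.2 : ℝ))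

/-- `L_p(z₁, z₂) = max {1, ‖z₁‖, ‖z₂‖} ^ (p - 1)`. -/
def growthL (p : ℝ) (z₁ z₂ : X × Y) : ℝ :=
  max 1 (max ‖vec z₁‖ ‖vec z₂‖) ^ (p - 1)

/-- First derivative of the cost `c (z, w)` in its second argument `w`. -/
def cost' (c : X × Y → ℝ → ℝ) (z : X × Y) (w : ℝ) : ℝ := deriv (c z) w

/-- Second derivative of the cost `c (z, w)` in its second argument `w`. -/
def cost'' (c : X × Y → ℝ → ℝ) (z : X × Y) (w : ℝ) : ℝ := deriv (deriv (c z)) w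

/-- Local Lipschitz condition on the second derivative of the cost. -/
def SecondDerivLipschitz (c : X × Y → ℝ → ℝ) (C p : ℝ) : Prop :=
  ∀ (z₁ z₂ : X × Y) (w₁ w₂ : ℝ),
    |cost'' c z₁ w₁ - cost'' c z₂ w₂| ≤
      C * growthL p z₁ z₂ * (‖vec z₁ - vec z₂‖ + |w₁ - w₂|)

/-- The mixture `(1 - t) P + t δ_z̃`. -/
def mixture (P : Measure (X × Y)) (zt : X × Y) (t : ℝ) : Measure (X × Y) :=
  ENNReal.ofReal (1 - t) • P + ENNReal.ofReal t • Measure.dirac zt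

variable {H : Type*} [NormedAddCommGroup H] [InnerProductSpace ℝ H] [CompleteSpace H]
  [RKHS ℝ H X ℝ]

variable (H) in
/-- The kernel section `k_x = k (·, x)`, as an element of the reproducing kernel Hilbert space. -/
def kerSec (x : X) : H := RKHS.kerFun H x (1 : ℝ)

/-- The operator `T_x h = ⟨k_x, h⟩ k_x`. -/
def opT (x : X) (h : H) : H := inner ℝ (kerSec H x) h • kerSec H x

/-- `E_Q [c'₂(z, f(x)) k_x]`. -/
def meanGrad (c : X × Y → ℝ → ℝ) (Q : Measure (X × Y)) (f : H) : H :=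
  ∫ z, cost' c z (f z.1) • kerSec H z.1 ∂Q

/-- `h ↦ E_Q [c''₂(z, f(x)) T_x h]`. -/
def meanHess (c : X × Y → ℝ → ℝ) (Q : Measure (X × Y)) (f : H) (h : H) : H :=
  ∫ z, cost'' c z (f z.1) • opT z.1 h ∂Q

/-- The Hessian operator `h ↦ E_Q [c''₂(z, f(x)) T_x h] + 2 λ h` of the regularized risk
`E_Q [c(z, f(x))] + λ ‖f‖²`. -/
def regHess (c : X × Y → ℝ → ℝ) (lam : ℝ) (Q : Measure (X × Y)) (f : H) (h : H) : H :=
  meanHess c Q f h + (2 * lam) • h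

/-- The probability distributions `Q` for which `E_Q [|c'₂(z, f(x))| ‖k_x‖]` and
`E_Q [|c''₂(z, f(x))| ‖T_x h‖]` are finite, at a given `f` and direction `h`. -/
def tildeP (c : X × Y → ℝ → ℝ) (f h : H) : Set (Measure (X × Y)) :=
  {Q | IsProbabilityMeasure Q ∧
    Integrable (fun z : X × Y => cost' c z (f z.1) • kerSec H z.1) Q ∧
    Integrable (fun z : X × Y => cost'' c z (f z.1) • opT z.1 h) Q}

/-- The solutions `f` of `0 ∈ E_Q [c'₂(z, f(x)) k_x] + 2 λ f + N_F(f)`. -/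
def regSolutions (c : X × Y → ℝ → ℝ) (F : Set H) (lam : ℝ) (Q : Measure (X × Y)) : Set H :=
  {f | ∃ d ∈ normalCone F f, meanGrad c Q f + (2 * lam) • f + d = 0}

/-- The solutions `h` of the linearized inclusion
`-c'₂(z̃, f(x̃)) k_x̃ + E_P [c'₂(z, f(x)) k_x] - E_P [c''₂(z, f(x)) T_x h] - 2 λ h ∈ D h`. -/
def linearizedSolutions (c : X × Y → ℝ → ℝ) (lam : ℝ) (P : Measure (X × Y)) (zt : X × Y) (f : H)
    (D : H → Set H) : Set H :=
  {h | -(cost' c zt (f zt.1) • kerSec H zt.1) + meanGrad c P f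
    - meanHess c P f h - (2 * lam) • h ∈ D h}

/-- `h` is the influence function, at the point `zt` and the distribution `P`, of the
functional `S` on distributions. -/
def HasInfluenceFunction (S : Measure (X × Y) → H) (P : Measure (X × Y)) (zt : X × Y) (h : H) :
    Prop :=
  Tendsto (fun t : ℝ => t⁻¹ • (S (mixture P zt t) - S P)) (𝓝[>] 0) (𝓝 h)

end Learning

end KernelIF

end

open KernelIF

open MeasureTheory Filter Topology Set

namespace KernelIF

/-! ### Monotonicity of normal cones and of their proto-derivatives. -/

section Proto

variable {H : Type*} [NormedAddCommGroup H] [InnerProductSpace ℝ H]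

/-! Write `f t` for the solution at the mixture. The multiplier `v t = -E[c'₂ k_x] - 2λ f t` lies in
the normal cone at `f t`, so differentiating `v t` at `t = 0` along the solution curve gives a point
of the outer limit of the difference quotients, hence of the proto-derivative
(`HasProtoDerivAt.mem_of_tendsto`). The derivative of `v t` comes from a Taylor expansion of the
mean gradient with a remainder quadratic in `‖g - f‖` (`norm_meanGrad_sub_le`), together with
continuity of the mean Hessian; this is `tendsto_multiplier_quotient`. Uniqueness uses the inner
limit: it makes the proto-derivative monotone, while convexity makes the mean Hessian positive
semidefinite, so `2λ‖g - h‖² ≤ 0` for two solutions. For `F = univ` the cone is `{0}`, all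
multipliers vanish, and so does the limit. -/

/-- The normal cone mapping is monotone. -/
lemma inner_sub_nonneg_of_mem_normalCone {F : Set H} {f g u v : H}
    (hu : u ∈ normalCone F f) (hv : v ∈ normalCone F g) :
    0 ≤ inner ℝ (u - v) (f - g) := by
  have h₁ := hu.2 g hv.1
  have h₂ := hv.2 f hu.1
  rw [← neg_sub f g, inner_neg_right] at h₁
  rw [inner_sub_left]
  linarith

/-- Proto-derivatives of the normal cone mapping are monotone. -/
lemma HasProtoDerivAt.inner_sub_nonneg {F : Set H} {f u : H} {D : H → Set H}
    (hD : HasProtoDerivAt (normalCone F) f u D) {h₁ h₂ w₁ w₂ : H}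
    (hw₁ : w₁ ∈ D h₁) (hw₂ : w₂ ∈ D h₂) : 0 ≤ inner ℝ (w₁ - w₂) (h₁ - h₂) := by
  have m₁ : (h₁, w₁) ∈ innerLimit (fun ε => gph (diffQuot (normalCone F) f u ε)) := by
    rw [hD.2.2]; exact hw₁
  have m₂ : (h₂, w₂) ∈ innerLimit (fun ε => gph (diffQuot (normalCone F) f u ε)) := by
    rw [hD.2.2]; exact hw₂
  -- Inner limits allow one common sequence for both points; outer limits would give two unrelated
  -- ones.
  obtain ⟨a, ha, ha'⟩ := m₁ (fun k => 1 / ((k : ℝ) + 1)) (fun k => by positivity)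
    tendsto_one_div_add_atTop_nhds_zero_nat
  obtain ⟨b, hb, hb'⟩ := m₂ (fun k => 1 / ((k : ℝ) + 1)) (fun k => by positivity)
    tendsto_one_div_add_atTop_nhds_zero_nat
  have hlim := (ha.snd_nhds.sub hb.snd_nhds).inner (𝕜 := ℝ) (ha.fst_nhds.sub hb.fst_nhds)
  refine ge_of_tendsto hlim ?_
  filter_upwards [ha', hb'] with k hak hbk
  obtain ⟨v, hv, hv'⟩ := hak
  obtain ⟨w, hw, hw'⟩ := hbk
  have hε : (0 : ℝ) < 1 / ((k : ℝ) + 1) := by positivity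
  generalize 1 / ((k : ℝ) + 1) = ε at *
  have h := inner_sub_nonneg_of_mem_normalCone hv hw
  rw [add_sub_add_left_eq_sub, ← smul_sub, inner_smul_right] at h
  rw [hv', hw', ← smul_sub, sub_sub_sub_cancel_right, inner_smul_left]
  exact mul_nonneg (by simpa using hε.le) (nonneg_of_mul_nonneg_right h hε)

lemma normalCone_univ (f : H) : normalCone (univ : Set H) f = {0} := by
  ext d
  simp only [normalCone, mem_univ, true_and, forall_const, mem_ofPred_eq, mem_singleton_iff]
  refine ⟨fun h => ?_, fun h g => by simp [h]⟩
  -- Testing with `f + d` gives `‖d‖² ≤ 0`.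
  have := h (f + d)
  rwa [add_sub_cancel_left, real_inner_self_nonpos] at this

end Proto

/-! ### Regularity of the cost and of the kernel sections. -/

section Learning

variable {n : ℕ} {X : Set (EuclideanSpace ℝ (Fin n))} {Y : Set ℝ}

lemma growthL_nonneg (p : ℝ) (z₁ z₂ : X × Y) : 0 ≤ growthL p z₁ z₂ := by
  unfold growthL; positivity

lemma continuous_vec : Continuous (vec : X × Y → EuclideanSpace ℝ (Fin n) × ℝ) := by
  unfold vec; fun_prop

lemma continuous_growthL_left (p : ℝ) (z₀ : X × Y) :
    Continuous fun z : X × Y => growthL p z z₀ := by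
  unfold growthL
  have := continuous_vec (X := X) (Y := Y)
  refine Continuous.rpow_const (by fun_prop) fun z => Or.inl ?_
  exact (zero_lt_one.trans_le (le_max_left _ _)).ne'

variable {c : X × Y → ℝ → ℝ} {C p : ℝ}

lemma SecondDerivLipschitz.continuous (hLip : SecondDerivLipschitz c C p) :
    Continuous (Function.uncurry (cost'' c)) := by
  rw [continuous_iff_continuousAt]
  rintro ⟨z₀, w₀⟩
  have hv := continuous_vec (X := X) (Y := Y)
  have hg := continuous_growthL_left p z₀
  have hcont : Continuous fun q : (X × Y) × ℝ =>
      C * growthL p q.1 z₀ * (‖vec q.1 - vec z₀‖ + |q.2 - w₀|) :=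
    (continuous_const.mul (hg.comp continuous_fst)).mul (by fun_prop)
  have hlim := hcont.tendsto (z₀, w₀)
  simp only [sub_self, norm_zero, abs_zero, add_zero, mul_zero] at hlim
  rw [ContinuousAt, tendsto_iff_dist_tendsto_zero]
  refine squeeze_zero (fun _ => dist_nonneg) (fun q => ?_) hlim
  exact hLip q.1 z₀ q.2 w₀

lemma hasDerivAt_cost' (hC2 : ∀ z, ContDiff ℝ 2 (c z)) (z : X × Y) (w : ℝ) :
    HasDerivAt (cost' c z) (cost'' c z w) w :=
  (((hC2 z).differentiable_deriv_two) w).hasDerivAt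

/-- A difference of values of `c'₂` is an integral of the jointly continuous `c''₂`. Continuity of
`c'₂` itself in `z` is not available, so measurability of the Taylor remainder rests on this. -/
lemma SecondDerivLipschitz.continuous_cost'_sub (hLip : SecondDerivLipschitz c C p)
    (hC2 : ∀ z, ContDiff ℝ 2 (c z)) {a b : X × Y → ℝ} (ha : Continuous a) (hb : Continuous b) :
    Continuous fun z => cost' c z (b z) - cost' c z (a z) := by
  have key : ∀ b : X × Y → ℝ, Continuous b →
      Continuous fun z => cost' c z (b z) - cost' c z 0 := fun b hb => by
    have h := intervalIntegral.continuous_parametric_intervalIntegral_of_continuous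
      (μ := volume) (a₀ := 0) hLip.continuous hb
    refine h.congr fun z => ?_
    refine intervalIntegral.integral_eq_sub_of_hasDerivAt (fun w _ => hasDerivAt_cost' hC2 z w) ?_
    exact (hLip.continuous.comp (by fun_prop : Continuous fun w : ℝ => (z, w))).intervalIntegrable
      _ _
  exact ((key b hb).sub (key a ha)).congr fun z => by
    simp only [Pi.sub_apply]; ring

/-- First order Taylor estimate for the derivative of the cost. -/
lemma SecondDerivLipschitz.abs_cost'_sub_le (hLip : SecondDerivLipschitz c C p) (hC : 0 ≤ C)
    (hC2 : ∀ z, ContDiff ℝ 2 (c z)) (z : X × Y) (a b : ℝ) :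
    |cost' c z b - cost' c z a - cost'' c z a * (b - a)| ≤ C * growthL p z z * (b - a) ^ 2 := by
  -- Mean value inequality for `c'₂` minus its linear part at `a`; with `z` fixed, only `|w - a|`
  -- remains in the Lipschitz bound.
  have hd : ∀ w ∈ uIcc a b, HasDerivWithinAt (fun w => cost' c z w - cost'' c z a * w)
      (cost'' c z w - cost'' c z a) (uIcc a b) w := fun w _ => by
    have h := (hasDerivAt_cost' hC2 z w).fun_sub ((hasDerivAt_id' w).const_mul (cost'' c z a))
    rw [mul_one] at h
    exact h.hasDerivWithinAt
  have hb : ∀ w ∈ uIcc a b,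
      ‖cost'' c z w - cost'' c z a‖ ≤ C * growthL p z z * |b - a| := fun w hw => by
    refine (hLip z z w a).trans ?_
    rw [sub_self, norm_zero, zero_add]
    exact mul_le_mul_of_nonneg_left (abs_sub_left_of_mem_uIcc hw)
      (mul_nonneg hC (growthL_nonneg _ _ _))
  have h := (convex_uIcc a b).norm_image_sub_le_of_norm_hasDerivWithin_le hd hb
    left_mem_uIcc right_mem_uIcc
  rw [Real.norm_eq_abs, Real.norm_eq_abs, mul_assoc, ← sq, sq_abs] at h
  convert h using 2
  ring

lemma cost''_nonneg (hC2 : ∀ z, ContDiff ℝ 2 (c z)) {z : X × Y} (hz : ConvexOn ℝ univ (c z))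
    (w : ℝ) : 0 ≤ cost'' c z w := by
  have hm := hz.monotoneOn_deriv fun x _ => ((hC2 z).differentiable (by norm_num)) x
  rw [monotoneOn_univ] at hm
  exact hm.deriv_nonneg

variable {H : Type*} [NormedAddCommGroup H] [InnerProductSpace ℝ H] [CompleteSpace H]
  [RKHS ℝ H X ℝ]

lemma apply_eq_inner_kerSec (f : H) (x : X) : f x = inner ℝ (kerSec H x) f := by
  simp [kerSec]

lemma abs_apply_le (f : H) (x : X) : |f x| ≤ ‖kerSec H x‖ * ‖f‖ := by
  rw [apply_eq_inner_kerSec]; exact abs_real_inner_le_norm _ _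

/-- Expanding the square, `‖k_x - k_y‖² = k(x,x) - 2k(x,y) + k(y,y)`, which tends to `0` as `x → y`.
-/
lemma continuous_kerSec (hk : Continuous fun p : X × X => RKHS.kernel H p.1 p.2 (1 : ℝ)) :
    Continuous (kerSec H : X → H) := by
  rw [continuous_iff_continuousAt]
  intro y
  have hin : ∀ x y : X, inner ℝ (kerSec H x) (kerSec H y) = RKHS.kernel H x y (1 : ℝ) := by
    intro x y
    rw [← apply_eq_inner_kerSec, kerSec, RKHS.kerFun_apply]
  have hsq : ∀ x : X, ‖kerSec H x - kerSec H y‖ ^ 2 =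
      RKHS.kernel H x x (1 : ℝ) - 2 * RKHS.kernel H x y (1 : ℝ) + RKHS.kernel H y y (1 : ℝ) := by
    intro x
    rw [norm_sub_sq_real, ← real_inner_self_eq_norm_sq, ← real_inner_self_eq_norm_sq, hin, hin, hin]
  have hc : Continuous fun x : X => ‖kerSec H x - kerSec H y‖ ^ 2 := by
    simp_rw [hsq]
    exact ((hk.comp (by fun_prop : Continuous fun x : X => (x, x))).sub (continuous_const.mul
      (hk.comp (by fun_prop : Continuous fun x : X => (x, y))))).add continuous_const
  have hc' : Continuous fun x : X => ‖kerSec H x - kerSec H y‖ :=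
    hc.sqrt.congr fun x => Real.sqrt_sq (norm_nonneg _)
  rw [ContinuousAt, tendsto_iff_norm_sub_tendsto_zero]
  simpa using hc'.tendsto y

lemma continuous_rkhs_apply (hk : Continuous fun p : X × X => RKHS.kernel H p.1 p.2 (1 : ℝ))
    (f : H) : Continuous (fun x : X => f x) := by
  simp_rw [apply_eq_inner_kerSec]
  exact (continuous_kerSec hk).inner continuous_const

/-! ### The Hessian of the risk -/

variable {Q : Measure (X × Y)} {f : H}

/-- The mean Hessian as a linear map, when all its defining integrals converge. -/
noncomputable def meanHessLin (hint : ∀ h : H, Integrable (fun z : X × Y => cost'' c z (f z.1) • opT z.1 h) Q) :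
    H →ₗ[ℝ] H where
  toFun := meanHess c Q f
  map_add' g h := by
    unfold meanHess
    rw [← integral_add (hint g) (hint h)]
    simp only [opT, inner_add_right, add_smul, smul_add]
  map_smul' a h := by
    unfold meanHess
    rw [RingHom.id_apply, ← integral_smul]
    simp only [opT, inner_smul_right, mul_smul, smul_comm a]

lemma inner_meanHess
    (hint : ∀ h : H, Integrable (fun z : X × Y => cost'' c z (f z.1) • opT z.1 h) Q) (g h : H) :
    inner ℝ g (meanHess c Q f h) = ∫ z, cost'' c z (f z.1) * (g z.1 * h z.1) ∂Q := by
  unfold meanHess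
  rw [← integral_inner (hint h)]
  congr with z
  rw [opT, inner_smul_right, inner_smul_right, ← real_inner_comm g, ← apply_eq_inner_kerSec,
    ← apply_eq_inner_kerSec]
  ring

lemma isSymmetric_meanHessLin
    (hint : ∀ h : H, Integrable (fun z : X × Y => cost'' c z (f z.1) • opT z.1 h) Q) :
    (meanHessLin hint).IsSymmetric := fun g h => by
  change inner ℝ (meanHess c Q f g) h = inner ℝ g (meanHess c Q f h)
  rw [real_inner_comm, inner_meanHess hint, inner_meanHess hint]
  simp only [mul_comm]

/-- Hellinger–Toeplitz: a symmetric operator defined on the whole Hilbert space is bounded, so no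
uniform integrability over directions is needed. -/
lemma continuous_meanHess
    (hint : ∀ h : H, Integrable (fun z : X × Y => cost'' c z (f z.1) • opT z.1 h) Q) :
    Continuous (meanHess c Q f) :=
  (isSymmetric_meanHessLin hint).continuous

lemma meanHess_self_nonneg (hconv : ∀ᵐ z ∂Q, ConvexOn ℝ univ (c z))
    (hC2 : ∀ z, ContDiff ℝ 2 (c z))
    (hint : ∀ h : H, Integrable (fun z : X × Y => cost'' c z (f z.1) • opT z.1 h) Q) (h : H) :
    0 ≤ inner ℝ h (meanHess c Q f h) := by
  rw [inner_meanHess hint]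
  refine integral_nonneg_of_ae ?_
  filter_upwards [hconv] with z hz
  exact mul_nonneg (cost''_nonneg hC2 hz _) (mul_self_nonneg _)

/-! ### Expansion of the gradient of the risk -/

/-- The integrand of the remainder in the expansion of the mean gradient around `f`. -/
noncomputable def gradRemainder (c : X × Y → ℝ → ℝ) (f g : H) (z : X × Y) : H :=
  (cost' c z (g z.1) - cost' c z (f z.1) - cost'' c z (f z.1) * (g z.1 - f z.1)) • kerSec H z.1

/-- The bound `|g(x) - f(x)| ≤ ‖k_x‖ ‖g - f‖` enters squared, and the factor `k_x` supplies the
third power of `‖k_x‖`. -/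
lemma norm_gradRemainder_le (hLip : SecondDerivLipschitz c C p) (hC : 0 ≤ C)
    (hC2 : ∀ z, ContDiff ℝ 2 (c z)) (f g : H) (z : X × Y) :
    ‖gradRemainder c f g z‖ ≤
      C * ‖g - f‖ ^ 2 * (growthL p z z * ‖kerSec H z.1‖ ^ 3) := by
  have h₁ := hLip.abs_cost'_sub_le hC hC2 z (f z.1) (g z.1)
  have h₂ : (g z.1 - f z.1) ^ 2 ≤ (‖kerSec H z.1‖ * ‖g - f‖) ^ 2 := by
    rw [sq_le_sq, abs_of_nonneg (a := ‖kerSec H z.1‖ * ‖g - f‖) (by positivity)]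
    simpa using abs_apply_le (g - f) z.1
  have hL := growthL_nonneg p z z
  rw [gradRemainder, norm_smul, Real.norm_eq_abs]
  calc _ ≤ C * growthL p z z * (‖kerSec H z.1‖ * ‖g - f‖) ^ 2 * ‖kerSec H z.1‖ := by
        refine mul_le_mul_of_nonneg_right (h₁.trans ?_) (norm_nonneg _)
        exact mul_le_mul_of_nonneg_left h₂ (mul_nonneg hC hL)
    _ = _ := by ring

lemma integrable_gradRemainder
    (hk : Continuous fun p : X × X => RKHS.kernel H p.1 p.2 (1 : ℝ))
    (hLip : SecondDerivLipschitz c C p) (hC : 0 ≤ C) (hC2 : ∀ z, ContDiff ℝ 2 (c z))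
    (hmom : Integrable (fun z : X × Y => growthL p z z * ‖kerSec H z.1‖ ^ 3) Q) (f g : H) :
    Integrable (gradRemainder c f g) Q := by
  refine (hmom.const_mul (C * ‖g - f‖ ^ 2)).mono' ?_
    (Eventually.of_forall (norm_gradRemainder_le hLip hC hC2 f g))
  have hf : Continuous fun z : X × Y => f z.1 := (continuous_rkhs_apply hk f).comp continuous_fst
  have hg : Continuous fun z : X × Y => g z.1 := (continuous_rkhs_apply hk g).comp continuous_fst
  have h'' : Continuous fun z : X × Y => cost'' c z (f z.1) :=
    hLip.continuous.comp (continuous_id.prodMk hf)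
  exact (((hLip.continuous_cost'_sub hC2 hf hg).sub (h''.mul (hg.sub hf))).smul
    ((continuous_kerSec hk).comp continuous_fst)).aestronglyMeasurable

lemma cost'_smul_kerSec_eq (f g : H) (z : X × Y) :
    cost' c z (g z.1) • kerSec H z.1 = cost' c z (f z.1) • kerSec H z.1 +
      cost'' c z (f z.1) • opT z.1 (g - f) + gradRemainder c f g z := by
  rw [opT, gradRemainder, ← apply_eq_inner_kerSec, smul_smul, ← add_smul, ← add_smul,
    RKHS.coe_sub, Pi.sub_apply]
  congr 1
  ring

/-- Integrability is assumed at `f` only; the Taylor identity carries it to every `g`. -/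
lemma integrable_grad
    (hk : Continuous fun p : X × X => RKHS.kernel H p.1 p.2 (1 : ℝ))
    (hLip : SecondDerivLipschitz c C p) (hC : 0 ≤ C) (hC2 : ∀ z, ContDiff ℝ 2 (c z))
    (hmom : Integrable (fun z : X × Y => growthL p z z * ‖kerSec H z.1‖ ^ 3) Q)
    (hQ : ∀ h : H, Q ∈ tildeP c f h) (g : H) :
    Integrable (fun z : X × Y => cost' c z (g z.1) • kerSec H z.1) Q := by
  simp_rw [cost'_smul_kerSec_eq f g]
  -- The direction `0` is arbitrary: the gradient condition does not depend on it.
  exact ((hQ 0).2.1.add (hQ (g - f)).2.2).add (integrable_gradRemainder hk hLip hC hC2 hmom f g)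

lemma norm_meanGrad_sub_le
    (hk : Continuous fun p : X × X => RKHS.kernel H p.1 p.2 (1 : ℝ))
    (hLip : SecondDerivLipschitz c C p) (hC : 0 ≤ C) (hC2 : ∀ z, ContDiff ℝ 2 (c z))
    (hmom : Integrable (fun z : X × Y => growthL p z z * ‖kerSec H z.1‖ ^ 3) Q)
    (hQ : ∀ h : H, Q ∈ tildeP c f h) (g : H) :
    ‖meanGrad c Q g - meanGrad c Q f - meanHess c Q f (g - f)‖ ≤
      C * (∫ z, growthL p z z * ‖kerSec H z.1‖ ^ 3 ∂Q) * ‖g - f‖ ^ 2 := by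
  have h₁ := (hQ 0).2.1
  have h₂ := (hQ (g - f)).2.2
  have h₃ := integrable_gradRemainder hk hLip hC hC2 hmom f g
  have heq : meanGrad c Q g - meanGrad c Q f - meanHess c Q f (g - f) =
      ∫ z, gradRemainder c f g z ∂Q := by
    have : meanGrad c Q g = meanGrad c Q f + meanHess c Q f (g - f) +
        ∫ z, gradRemainder c f g z ∂Q := by
      unfold meanGrad meanHess
      rw [← integral_add h₁ h₂, ← integral_add (h₁.fun_add h₂) h₃]
      exact integral_congr_ae (Eventually.of_forall (cost'_smul_kerSec_eq f g))
    rw [this]; abel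
  rw [heq]
  refine (norm_integral_le_of_norm_le (hmom.const_mul (C * ‖g - f‖ ^ 2))
    (Eventually.of_forall (norm_gradRemainder_le hLip hC hC2 f g))).trans_eq ?_
  rw [integral_const_mul]
  ring

lemma meanGrad_mixture {P : Measure (X × Y)} {zt : X × Y} {t : ℝ} (ht₀ : 0 ≤ t) (ht₁ : t ≤ 1)
    {g : H} (hg : Integrable (fun z : X × Y => cost' c z (g z.1) • kerSec H z.1) P) :
    meanGrad c (mixture P zt t) g =
      (1 - t) • meanGrad c P g + t • cost' c zt (g zt.1) • kerSec H zt.1 := by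
  unfold meanGrad mixture
  have hd : Integrable (fun z : X × Y => cost' c z (g z.1) • kerSec H z.1)
      (Measure.dirac zt) := integrable_dirac (by simp)
  rw [integral_add_measure (hg.smul_measure ENNReal.ofReal_ne_top)
    (hd.smul_measure ENNReal.ofReal_ne_top), integral_smul_measure, integral_smul_measure,
    integral_dirac, ENNReal.toReal_ofReal (by linarith), ENNReal.toReal_ofReal ht₀]

/-- Difference quotients of the mean gradient along a differentiable curve. -/
lemma tendsto_meanGrad_quotient
    (hk : Continuous fun p : X × X => RKHS.kernel H p.1 p.2 (1 : ℝ))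
    (hLip : SecondDerivLipschitz c C p) (hC : 0 ≤ C) (hC2 : ∀ z, ContDiff ℝ 2 (c z))
    (hmom : Integrable (fun z : X × Y => growthL p z z * ‖kerSec H z.1‖ ^ 3) Q)
    (hQ : ∀ h : H, Q ∈ tildeP c f h) {φ : ℝ → H} {h : H}
    (hφ : Tendsto (fun t : ℝ => t⁻¹ • (φ t - f)) (𝓝[>] 0) (𝓝 h)) :
    Tendsto (fun t : ℝ => t⁻¹ • (meanGrad c Q (φ t) - meanGrad c Q f)) (𝓝[>] 0)
      (𝓝 (meanHess c Q f h)) := by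
  have hint : ∀ h : H, Integrable (fun z : X × Y => cost'' c z (f z.1) • opT z.1 h) Q :=
    fun h => (hQ h).2.2
  have hmain := ((continuous_meanHess hint).tendsto h).comp hφ
  set M := ∫ z, growthL p z z * ‖kerSec H z.1‖ ^ 3 ∂Q
  have hid : Tendsto (fun t : ℝ => t) (𝓝[>] 0) (𝓝 0) := tendsto_id.mono_left nhdsWithin_le_nhds
  -- A remainder of order `‖φ t - f‖²`, divided by `t`, is `t` times the squared norm of a
  -- convergent quotient.
  have hbd : Tendsto (fun t : ℝ => C * M * (t * ‖t⁻¹ • (φ t - f)‖ ^ 2)) (𝓝[>] 0) (𝓝 0) := by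
    simpa using (hid.mul (hφ.norm.pow 2)).const_mul (C * M)
  have hrem : Tendsto (fun t : ℝ => t⁻¹ • (meanGrad c Q (φ t) - meanGrad c Q f) -
      meanHess c Q f (t⁻¹ • (φ t - f))) (𝓝[>] 0) (𝓝 0) := by
    refine squeeze_zero_norm' ?_ hbd
    filter_upwards [self_mem_nhdsWithin] with t ht
    have ht : (0 : ℝ) < t := ht
    have hsm : meanHess c Q f (t⁻¹ • (φ t - f)) = t⁻¹ • meanHess c Q f (φ t - f) :=
      (meanHessLin hint).map_smul _ _
    rw [hsm, ← smul_sub, norm_smul, norm_smul, Real.norm_of_nonneg (inv_nonneg.2 ht.le)]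
    refine (mul_le_mul_of_nonneg_left (norm_meanGrad_sub_le hk hLip hC hC2 hmom hQ (φ t))
      (inv_nonneg.2 ht.le)).trans_eq ?_
    field_simp
    ring
  simpa [Function.comp_def] using hrem.add hmain

lemma tendsto_of_tendsto_quotient {E : Type*} [NormedAddCommGroup E] [NormedSpace ℝ E]
    {φ : ℝ → E} {f h : E}
    (hφ : Tendsto (fun t : ℝ => t⁻¹ • (φ t - f)) (𝓝[>] 0) (𝓝 h)) :
    Tendsto φ (𝓝[>] 0) (𝓝 f) := by
  have hid : Tendsto (fun t : ℝ => t) (𝓝[>] 0) (𝓝 0) := tendsto_id.mono_left nhdsWithin_le_nhds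
  have h₁ : Tendsto (fun t : ℝ => f + t • t⁻¹ • (φ t - f)) (𝓝[>] 0) (𝓝 f) := by
    simpa using (hid.smul hφ).const_add f
  refine h₁.congr' ?_
  filter_upwards [self_mem_nhdsWithin] with t ht
  rw [smul_inv_smul₀ (ne_of_gt ht), add_sub_cancel]

/-- Difference quotients of the multipliers `-E_Q [c'₂(z, φ(x)) k_x] - 2 λ φ` along the mixtures
`Q = (1 - t) P + t δ_z̃`. -/
lemma tendsto_multiplier_quotient {P : Measure (X × Y)}
    (hk : Continuous fun p : X × X => RKHS.kernel H p.1 p.2 (1 : ℝ))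
    (hLip : SecondDerivLipschitz c C p) (hC : 0 ≤ C) (hC2 : ∀ z, ContDiff ℝ 2 (c z))
    (hmom : Integrable (fun z : X × Y => growthL p z z * ‖kerSec H z.1‖ ^ 3) P)
    (hP : ∀ h : H, P ∈ tildeP c f h) (zt : X × Y) (lam : ℝ) {φ : ℝ → H} {h : H}
    (hφ : Tendsto (fun t : ℝ => t⁻¹ • (φ t - f)) (𝓝[>] 0) (𝓝 h)) :
    Tendsto (fun t : ℝ => t⁻¹ • ((-meanGrad c (mixture P zt t) (φ t) - (2 * lam) • φ t) -
        (-meanGrad c P f - (2 * lam) • f))) (𝓝[>] 0)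
      (𝓝 (-(cost' c zt (f zt.1) • kerSec H zt.1) + meanGrad c P f
        - meanHess c P f h - (2 * lam) • h)) := by
  have hgq := tendsto_meanGrad_quotient hk hLip hC hC2 hmom hP hφ
  have hg := tendsto_of_tendsto_quotient hgq
  have hev : Tendsto (fun t => φ t zt.1) (𝓝[>] 0) (𝓝 (f zt.1)) :=
    ((RKHS.continuous_eval zt.1).tendsto f).comp (tendsto_of_tendsto_quotient hφ)
  have hc : Tendsto (fun t => cost' c zt (φ t zt.1)) (𝓝[>] 0) (𝓝 (cost' c zt (f zt.1))) :=
    (hasDerivAt_cost' hC2 zt _).continuousAt.tendsto.comp hev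
  have hlim := (((hc.smul_const (kerSec H zt.1)).neg.add hg).sub hgq).sub
    (hφ.const_smul (2 * lam))
  refine hlim.congr' ?_
  filter_upwards [Ioo_mem_nhdsGT (zero_lt_one' ℝ)] with t ht
  rw [meanGrad_mixture ht.1.le ht.2.le (integrable_grad hk hLip hC hC2 hmom hP (φ t))]
  have ht' : t ≠ 0 := ht.1.ne'
  match_scalars <;> field_simp
  all_goals ring

lemma neg_meanGrad_sub_mem_normalCone {F : Set H} {lam : ℝ} {g : H}
    (hg : g ∈ regSolutions c F lam Q) :
    -meanGrad c Q g - (2 * lam) • g ∈ normalCone F g := by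
  obtain ⟨d, hd, h⟩ := hg
  rwa [← neg_add', ← eq_neg_of_add_eq_zero_right h]

/-- Limits of difference quotients of selections of `Γ` along differentiable curves lie in the
proto-derivative. -/
lemma HasProtoDerivAt.mem_of_tendsto {E : Type*} [NormedAddCommGroup E] [InnerProductSpace ℝ E]
    {Γ D : E → Set E} {f u h w : E} (hD : HasProtoDerivAt Γ f u D) {φ v : ℝ → E}
    (hv : ∀ t ∈ Ioo (0 : ℝ) 1, v t ∈ Γ (φ t))
    (hφ : Tendsto (fun t : ℝ => t⁻¹ • (φ t - f)) (𝓝[>] 0) (𝓝 h))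
    (hw : Tendsto (fun t : ℝ => t⁻¹ • (v t - u)) (𝓝[>] 0) (𝓝 w)) : w ∈ D h := by
  suffices (h, w) ∈ gph D from this
  rw [← hD.2.1]
  -- The shifted index starts the sequence at `1/2`, since `hv` covers only `t < 1`.
  let t : ℕ → ℝ := fun k => 1 / (((k + 1 : ℕ) : ℝ) + 1)
  have ht₀ : ∀ k, 0 < t k := fun k => by positivity
  have ht₁ : ∀ k, t k < 1 := fun k => by
    rw [div_lt_one (by positivity)]
    have : (0 : ℝ) ≤ k := k.cast_nonneg
    push_cast
    linarith
  have ht : Tendsto t atTop (𝓝 0) :=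
    (tendsto_add_atTop_iff_nat 1).2 tendsto_one_div_add_atTop_nhds_zero_nat
  have ht' : Tendsto t atTop (𝓝[>] 0) :=
    tendsto_nhdsWithin_iff.2 ⟨ht, Eventually.of_forall ht₀⟩
  refine ⟨t, ht₀, ht, fun k => ((t k)⁻¹ • (φ (t k) - f), (t k)⁻¹ • (v (t k) - u)),
    (hφ.comp ht').prodMk_nhds (hw.comp ht'), fun k => ⟨v (t k), ?_, rfl⟩⟩
  change v (t k) ∈ Γ (f + t k • (t k)⁻¹ • (φ (t k) - f))
  rw [smul_inv_smul₀ (ht₀ k).ne', add_sub_cancel]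
  exact hv _ ⟨ht₀ k, ht₁ k⟩

/-- For `λ > 0` the linearized inclusion has at most one solution. -/
lemma linearizedSolutions_subsingleton {P : Measure (X × Y)} {zt : X × Y} {F : Set H} {lam : ℝ}
    {u : H} {D : H → Set H} (hlam : 0 < lam) (hconv : ∀ᵐ z ∂P, ConvexOn ℝ univ (c z))
    (hC2 : ∀ z, ContDiff ℝ 2 (c z))
    (hint : ∀ h : H, Integrable (fun z : X × Y => cost'' c z (f z.1) • opT z.1 h) P)
    (hD : HasProtoDerivAt (normalCone F) f u D) :
    (linearizedSolutions c lam P zt f D).Subsingleton := by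
  intro g hg h hh
  have hmono := hD.inner_sub_nonneg hg hh
  have hpos := meanHess_self_nonneg hconv hC2 hint (g - h)
  have hsub : meanHess c P f (g - h) = meanHess c P f g - meanHess c P f h :=
    (meanHessLin hint).map_sub _ _
  have heq : (-(cost' c zt (f zt.1) • kerSec H zt.1) + meanGrad c P f
      - meanHess c P f g - (2 * lam) • g) - (-(cost' c zt (f zt.1) • kerSec H zt.1) +
      meanGrad c P f - meanHess c P f h - (2 * lam) • h) =
      -meanHess c P f (g - h) - (2 * lam) • (g - h) := by
    rw [hsub, smul_sub]; abel
  rw [heq, inner_sub_left, inner_neg_left, real_inner_smul_left, real_inner_comm,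
    real_inner_self_eq_norm_sq] at hmono
  have hz : ‖g - h‖ ^ 2 ≤ 0 := by
    by_contra! hlt
    have := mul_pos hlam hlt
    linarith
  rw [← sub_eq_zero, ← norm_eq_zero]
  exact pow_eq_zero_iff two_ne_zero |>.1 (le_antisymm hz (sq_nonneg _))

end Learning

end KernelIF

theorem proposition4 {n : ℕ} {X : Set (EuclideanSpace ℝ (Fin n))} {Y : Set ℝ}
    {H : Type*} [NormedAddCommGroup H] [InnerProductSpace ℝ H] [CompleteSpace H]
    [RKHS ℝ H X ℝ]
    (hk : Continuous fun p : X × X => RKHS.kernel H p.1 p.2 (1 : ℝ))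
    (F : Set H) (hF : Convex ℝ F)
    (lam : ℝ) (hlam : 0 ≤ lam)
    (c : X × Y → ℝ → ℝ)
    (P : Measure (X × Y)) [IsProbabilityMeasure P]
    (hconv : ∀ᵐ z ∂P, ConvexOn ℝ univ (c z))
    (hC2 : ∀ z, ContDiff ℝ 2 (c z))
    (C₂ p₂ : ℝ) (hC₂ : 0 < C₂) (hp₂ : 1 ≤ p₂)
    (hLip : SecondDerivLipschitz c C₂ p₂)
    (hmom : Integrable (fun z : X × Y => growthL p₂ z z * ‖kerSec H z.1‖ ^ 3) P)
    (S : Measure (X × Y) → H) (zt : X × Y)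
    (hSP : regSolutions c F lam P = {S P})
    (hS : ∀ t ∈ Ioo (0 : ℝ) 1,
      regSolutions c F lam (mixture P zt t) = {S (mixture P zt t)})
    (hP : ∀ h : H, P ∈ tildeP c (S P) h)
    (h₀ : H) (hIF : HasInfluenceFunction S P zt h₀) :
    (∀ D : H → Set H,
      HasProtoDerivAt (normalCone F) (S P) (-meanGrad c P (S P) - (2 * lam) • S P) D →
      h₀ ∈ linearizedSolutions c lam P zt (S P) D ∧
      (0 < lam → linearizedSolutions c lam P zt (S P) D = {h₀})) ∧
    (F = univ → ∀ hbij : Function.Bijective (regHess c lam P (S P)),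
      h₀ = -(Equiv.ofBijective (regHess c lam P (S P)) hbij).symm
        (cost' c zt (S P zt.1) • kerSec H zt.1 - meanGrad c P (S P))) := by
  have hint : ∀ h : H, Integrable (fun z : X × Y => cost'' c z (S P z.1) • opT z.1 h) P :=
    fun h => (hP h).2.2
  have hcone : ∀ t ∈ Ioo (0 : ℝ) 1,
      -meanGrad c (mixture P zt t) (S (mixture P zt t)) - (2 * lam) • S (mixture P zt t) ∈
        normalCone F (S (mixture P zt t)) := fun t ht =>
    neg_meanGrad_sub_mem_normalCone (by rw [hS t ht]; rfl)
  have hlim := tendsto_multiplier_quotient hk hLip hC₂.le hC2 hmom hP zt lam hIF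
  refine ⟨fun D hD => ?_, fun hFu hbij => ?_⟩
  · have hmem : h₀ ∈ linearizedSolutions c lam P zt (S P) D :=
      hD.mem_of_tendsto hcone hIF hlim
    refine ⟨hmem, fun hpos => ?_⟩
    exact (linearizedSolutions_subsingleton hpos hconv hC2 hint hD).eq_singleton_of_mem hmem
  · subst hFu
    simp only [normalCone_univ, mem_singleton_iff] at hcone
    have hu : -meanGrad c P (S P) - (2 * lam) • S P = 0 := by
      have := neg_meanGrad_sub_mem_normalCone (c := c) (F := univ) (lam := lam) (Q := P)
        (g := S P) (by rw [hSP]; rfl)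
      rwa [normalCone_univ] at this
    -- Both multipliers are zero, so the quotient is identically `0` on `(0, 1)`.
    have hzero := tendsto_nhds_unique hlim (tendsto_const_nhds.congr' (f₁ := fun _ => (0 : H)) (by
      filter_upwards [Ioo_mem_nhdsGT (zero_lt_one' ℝ)] with t ht
      rw [hcone t ht, hu, sub_zero, smul_zero]))
    -- Moving the sign onto `h₀` lets the inverse be replaced by an equation for `regHess` at `-h₀`.
    rw [eq_neg_iff_add_eq_zero, add_comm, ← eq_neg_iff_add_eq_zero, Equiv.symm_apply_eq,
      Equiv.ofBijective_apply, regHess]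
    have hneg : meanHess c P (S P) (-h₀) = -meanHess c P (S P) h₀ :=
      (meanHessLin hint).map_neg _
    rw [hneg, smul_neg, ← sub_eq_zero, ← neg_eq_zero, ← hzero]
    abel
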